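/- **Theorem.** Let $n\ge 2$, $k\ge 2$, $d\ge 0$ be integers, let $S_n$ be the symmetric group on $\{1,\dots,n\}$ and let $S_{n-2}\le S_n$ be the subgroup fixing $n-1$ and $n$. For a partition $\mu$ of $n$ let $\rho_\mu$ be the Young orthogonal representation of $S_n$ labelled by $\mu$: its matrices are indexed by the standard Young tableaux of shape $\mu$, and $\rho_\mu((i,i+1))e_T=\frac1r e_T+\sqrt{1-\frac1{r^2}}\;e_{T'}$, where $r$ is the content (column minus row) of $i+1$ in $T$ minus the content of $i$ in $T$, and $T'$ is $T$ with $i$ and $i+1$ exchanged (the second term is $0$ if $T'$ is not standard). For $\varphi:S_n\to\mathbb C$ put $\hat\varphi(\rho)=\frac1{n!}\sum_{g\in S_n}\varphi(g)\rho(g)$. For $f=(f_1,\dots,f_d):S_n\to\mathbb C^d$, $G=(g_1,\dots,g_{k-2})\in S_n^{k-2}$ and $\rho=\rho_\mu$, the entry of the Multi-Orbit $k$-Spectrum of $f$ at $(G,\rho)$ is the block-diagonal matrix $$\hat{\mathcal S}^{(k)}_f(G,\rho)=\bigoplus_{(i_1,\dots,i_k)\in[d]^k}\hat r_{(i_1,\dots,i_{k-1})}(G,\rho)^\dagger\,\hat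 f_{i_k}(\rho),$$ $$\hat r_{(i_1,\dots,i_{k-1})}(G,\rho)=\frac1{n!}\sum_{g\in S_n}f_{i_{k-1}}(g)\prod_{l=1}^{k-2}f_{i_l}(g g_l)\;\rho(g).$$ Let $\Lambda_n$ be the set of those of $(n),(n-1,1),(n-2,2),(n-2,1,1)$ that are partitions of $n$, and let $Y\subset S_n$ be any transversal of the left cosets $S_n/S_{n-2}$ (exactly one representative of each coset). Then the $k$-Spectrum of a function on $S_n/S_{n-2}$ is uniquely determined by its entries with $\mu\in\Lambda_n$ and $G\in Y^{k-2}$. That is, if $f,f':S_n\to\mathbb C^d$ satisfy $f(gh)=f(g)$ and $f'(gh)=f'(g)$ for all $g\in S_n$, $h\in S_{n-2}$, and $$\hat{\mathcal S}^{(k)}_f(G,\rho_\mu)=\hat{\mathcal S}^{(k)}_{f'}(G,\rho_\mu)\quad\text{for all }\mu\in\Lambda_n,\ G\in Y^{k-2},$$ then the same equality holds for every partition $\mu$ of $n$ and every $G\in S_n^{k-2}$. -/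

import Mathlib

namespace KSpec

section Coxeter

variable {P : Type*} [Group P]

/-- The Coxeter relations of type `A` for the elements `c 0, …, c (N - 1)`. -/
structure CoxeterRel (c : ℕ → P) (N : ℕ) : Prop where
  sq : ∀ i, i < N → c i * c i = 1
  comm : ∀ i j, i + 1 < j → j < N → c i * c j = c j * c i
  braid : ∀ i, i + 1 < N → c i * c (i + 1) * c i = c (i + 1) * c i * c (i + 1)

/-- The product `c j * c (j + 1) * ⋯ * c (j + l - 1)`. -/
def ascProd (c : ℕ → P) : ℕ → ℕ → P
  | _, 0 => 1
  | j, l + 1 => c j * ascProd c (j + 1) l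

theorem ascProd_comm {c : ℕ → P} {N : ℕ} (h : CoxeterRel c N) (i : ℕ) :
    ∀ l j, i + 1 < j → j + l ≤ N → c i * ascProd c j l = ascProd c j l * c i := by
  intro l
  induction l with
  | zero => intro j _ _; simp [ascProd]
  | succ l ih =>
    intro j hj hl
    rw [ascProd, ← mul_assoc, h.comm i j hj (by omega), mul_assoc, ih (j + 1) (by omega) (by omega),
      mul_assoc]

theorem ascProd_shift {c : ℕ → P} {N : ℕ} (h : CoxeterRel c N) :
    ∀ l j i, j ≤ i → i + 1 < j + l → j + l ≤ N →
      c (i + 1) * ascProd c j l = ascProd c j l * c i := by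
  intro l
  induction l with
  | zero => intro j i _ _ _; omega
  | succ l ih =>
    intro j i hj hi hl
    rcases Nat.eq_or_lt_of_le hj with rfl | hlt
    · obtain ⟨l, rfl⟩ : ∃ l', l = l' + 1 := ⟨l - 1, by omega⟩
      simp only [ascProd]
      calc c (j + 1) * (c j * (c (j + 1) * ascProd c (j + 1 + 1) l))
          = (c (j + 1) * c j * c (j + 1)) * ascProd c (j + 1 + 1) l := by simp only [mul_assoc]
        _ = c j * c (j + 1) * (c j * ascProd c (j + 1 + 1) l) := by
            rw [← h.braid j (by omega)]; simp only [mul_assoc]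
        _ = _ := by
            rw [ascProd_comm h j l (j + 1 + 1) (by omega) (by omega)]; simp only [mul_assoc]
    · rw [ascProd, ← mul_assoc, ← h.comm j (i + 1) (by omega) (by omega), mul_assoc,
        ih (j + 1) i (by omega) (by omega) (by omega), mul_assoc]

theorem exists_ascProd {c : ℕ → P} {N : ℕ} (h : CoxeterRel c N) (m : ℕ) (hm : m + 1 ≤ N) (x : P)
    (hx : x ∈ Submonoid.closure (c '' Set.Iio (m + 1))) :
    ∃ j l, j + l = m + 1 ∧ ∃ y ∈ Submonoid.closure (c '' Set.Iio m), x = ascProd c j l * y := by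
  induction hx using Submonoid.closure_induction_left with
  | one => exact ⟨m + 1, 0, rfl, 1, one_mem _, by simp [ascProd]⟩
  | mul_left z hz w _ ih =>
    obtain ⟨i, hi, rfl⟩ := hz
    obtain ⟨j, l, hjl, y, hy, rfl⟩ := ih
    have hi' : i < m + 1 := hi
    rcases lt_trichotomy i j with hij | rfl | hij
    · rcases Nat.eq_or_lt_of_le (Nat.succ_le_of_lt hij) with rfl | hlt
      · exact ⟨i, l + 1, by omega, y, hy, by simp [ascProd, mul_assoc]⟩
      · refine ⟨j, l, hjl, c i * y, mul_mem (Submonoid.subset_closure ⟨i, ?_, rfl⟩) hy, ?_⟩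
        · show i < m
          omega
        · rw [← mul_assoc, ascProd_comm h i l j (by omega) (by omega), mul_assoc]
    · obtain ⟨l, rfl⟩ : ∃ l', l = l' + 1 := ⟨l - 1, by omega⟩
      refine ⟨i + 1, l, by omega, y, hy, ?_⟩
      rw [ascProd, ← mul_assoc, ← mul_assoc, h.sq i (by omega), one_mul]
    · obtain ⟨i, rfl⟩ : ∃ i', i = i' + 1 := ⟨i - 1, by omega⟩
      refine ⟨j, l, hjl, c i * y, mul_mem (Submonoid.subset_closure ⟨i, ?_, rfl⟩) hy, ?_⟩
      · show i < m
        omega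
      · rw [← mul_assoc, ascProd_shift h l j i (by omega) (by omega) (by omega), mul_assoc]

/-- The transposition of the `i`-th and the `(i + 1)`-st letter (counted from `0`), for
`i + 1 < n`. -/
def adjSwap (n i : ℕ) : Equiv.Perm (Fin n) :=
  if h : i + 1 < n then Equiv.swap ⟨i, by omega⟩ ⟨i + 1, h⟩ else 1

theorem adjSwap_apply {n i : ℕ} (h : i + 1 < n) (a : Fin n) :
    ((adjSwap n i a : Fin n) : ℕ) =
      if (a : ℕ) = i then i + 1 else if (a : ℕ) = i + 1 then i else a := by
  unfold adjSwap
  rw [dif_pos h, Equiv.swap_apply_def]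
  simp only [Fin.ext_iff]
  split_ifs <;> simp

theorem adjSwap_coxeterRel (n : ℕ) : CoxeterRel (adjSwap n) (n - 1) where
  sq i hi := by
    unfold adjSwap
    rw [dif_pos (by omega)]
    exact Equiv.swap_mul_self _ _
  comm i j hij hj := by
    ext a
    simp only [Equiv.Perm.mul_apply]
    rw [adjSwap_apply (by omega), adjSwap_apply (by omega), adjSwap_apply (by omega),
      adjSwap_apply (by omega)]
    split_ifs <;> omega
  braid i hi := by
    ext a
    simp only [Equiv.Perm.mul_apply]
    rw [adjSwap_apply (by omega), adjSwap_apply (by omega), adjSwap_apply (by omega),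
      adjSwap_apply (by omega), adjSwap_apply (by omega), adjSwap_apply (by omega)]
    split_ifs <;> omega

theorem closure_adjSwap (n : ℕ) :
    Submonoid.closure (adjSwap n '' Set.Iio (n - 1)) = ⊤ := by
  cases n with
  | zero => exact Subsingleton.elim _ _
  | succ n =>
    rw [eq_top_iff, ← Equiv.Perm.mclosure_swap_castSucc_succ n, Submonoid.closure_le]
    rintro _ ⟨i, rfl⟩
    refine Submonoid.subset_closure ⟨i, by simp, ?_⟩
    unfold adjSwap
    rw [dif_pos (by simp)]
    rfl

variable {n : ℕ} {a : ℕ → P}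

theorem ascProd_fst_apply :
    ∀ l j (h : j + l < n),
      ((ascProd (fun i => (adjSwap n i, a i)) j l).1 ⟨j + l, h⟩ : Fin n) = ⟨j, by omega⟩ := by
  intro l
  induction l with
  | zero => intro j h; simp [ascProd]
  | succ l ih =>
    intro j h
    have h1 := ih (j + 1) (by omega)
    have h2 : (⟨j + 1 + l, by omega⟩ : Fin n) = ⟨j + (l + 1), h⟩ := by
      ext; simp only; omega
    rw [h2] at h1
    simp only [ascProd, Prod.fst_mul, Equiv.Perm.mul_apply]
    rw [h1]
    ext
    rw [adjSwap_apply (by omega)]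
    simp

theorem fst_apply_of_mem (m : ℕ) (x : Equiv.Perm (Fin n) × P)
    (hx : x ∈ Submonoid.closure ((fun i => (adjSwap n i, a i)) '' Set.Iio m)) (b : Fin n)
    (hb : m < b) : x.1 b = b := by
  induction hx using Submonoid.closure_induction with
  | mem z hz =>
    obtain ⟨i, hi, rfl⟩ := hz
    have hi' : i < m := hi
    ext
    simp only
    rw [adjSwap_apply (by omega)]
    split_ifs <;> omega
  | one => rfl
  | mul z w _ _ h1 h2 => rw [Prod.fst_mul, Equiv.Perm.mul_apply, h2, h1]

theorem pair_coxeterRel (ha : CoxeterRel a (n - 1)) :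
    CoxeterRel (fun i => (adjSwap n i, a i)) (n - 1) where
  sq i hi := Prod.ext ((adjSwap_coxeterRel n).sq i hi) (ha.sq i hi)
  comm i j hij hj := Prod.ext ((adjSwap_coxeterRel n).comm i j hij hj) (ha.comm i j hij hj)
  braid i hi := Prod.ext ((adjSwap_coxeterRel n).braid i hi) (ha.braid i hi)

theorem eq_one_of_mem (ha : CoxeterRel a (n - 1)) :
    ∀ m, m ≤ n - 1 → ∀ x ∈ Submonoid.closure ((fun i => (adjSwap n i, a i)) '' Set.Iio m),
      x.1 = 1 → x = 1 := by
  intro m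
  induction m with
  | zero =>
    intro _ x hx _
    simpa using hx
  | succ m ih =>
    intro hm x hx h1
    obtain ⟨j, l, hjl, y, hy, rfl⟩ := exists_ascProd (pair_coxeterRel ha) m hm x hx
    have hy1 := fst_apply_of_mem m y hy ⟨m + 1, by omega⟩ (by simp)
    have h2 := congrArg (fun g : Equiv.Perm (Fin n) => g ⟨m + 1, by omega⟩) h1
    simp only [Prod.fst_mul, Equiv.Perm.mul_apply, Equiv.Perm.one_apply] at h2
    rw [hy1] at h2
    have h3 := ascProd_fst_apply (a := a) l j (show j + l < n by omega)
    have h4 : (⟨m + 1, by omega⟩ : Fin n) = ⟨j + l, by omega⟩ := by ext; exact hjl.symm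
    rw [h4, h3] at h2
    have h5 : j = j + l := by simpa [Fin.ext_iff] using h2
    obtain rfl : l = 0 := by omega
    simp only [ascProd, one_mul] at h1 ⊢
    exact ih (by omega) y hy h1

theorem existsUnique_snd (ha : CoxeterRel a (n - 1)) (g : Equiv.Perm (Fin n)) :
    ∃! p : P, (g, p) ∈
      Submonoid.closure ((fun i => (adjSwap n i, a i)) '' Set.Iio (n - 1)) := by
  have hex : ∃ p : P, (g, p) ∈
      Submonoid.closure ((fun i => (adjSwap n i, a i)) '' Set.Iio (n - 1)) := by
    have hg : g ∈ Submonoid.closure (adjSwap n '' Set.Iio (n - 1)) := by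
      rw [closure_adjSwap]; trivial
    induction hg using Submonoid.closure_induction with
    | mem z hz =>
      obtain ⟨i, hi, rfl⟩ := hz
      exact ⟨a i, Submonoid.subset_closure ⟨i, hi, rfl⟩⟩
    | one => exact ⟨1, one_mem _⟩
    | mul z w _ _ h1 h2 =>
      obtain ⟨p, hp⟩ := h1
      obtain ⟨q, hq⟩ := h2
      exact ⟨p * q, mul_mem hp hq⟩
  have hinv : ∀ x ∈ Submonoid.closure ((fun i => (adjSwap n i, a i)) '' Set.Iio (n - 1)),
      x⁻¹ ∈ Submonoid.closure ((fun i => (adjSwap n i, a i)) '' Set.Iio (n - 1)) := by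
    intro x hx
    induction hx using Submonoid.closure_induction with
    | mem z hz =>
      obtain ⟨i, hi, rfl⟩ := hz
      rw [inv_eq_of_mul_eq_one_left ((pair_coxeterRel ha).sq i hi)]
      exact Submonoid.subset_closure ⟨i, hi, rfl⟩
    | one => simp
    | mul z w _ _ h1 h2 => rw [mul_inv_rev]; exact mul_mem h2 h1
  obtain ⟨p, hp⟩ := hex
  refine ⟨p, hp, fun q hq => ?_⟩
  have := eq_one_of_mem ha (n - 1) le_rfl _ (mul_mem (hinv _ hp) hq) (by simp)
  have h2 := congrArg Prod.snd this
  simp only [Prod.snd_mul, Prod.snd_inv, Prod.snd_one] at h2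
  exact (inv_mul_eq_one.mp h2).symm

/-- The homomorphism on the symmetric group that sends the `i`-th adjacent transposition to `a i`,
for elements `a i` that satisfy the Coxeter relations. -/
noncomputable def liftCoxeter (ha : CoxeterRel a (n - 1)) : Equiv.Perm (Fin n) →* P where
  toFun g := (existsUnique_snd ha g).choose
  map_one' := ((existsUnique_snd ha 1).choose_spec.2 1 (one_mem _)).symm
  map_mul' g h := ((existsUnique_snd ha (g * h)).choose_spec.2 _
    (mul_mem (existsUnique_snd ha g).choose_spec.1 (existsUnique_snd ha h).choose_spec.1)).symm

theorem liftCoxeter_adjSwap (ha : CoxeterRel a (n - 1)) (i : ℕ) (hi : i + 1 < n) :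
    liftCoxeter ha (adjSwap n i) = a i :=
  ((existsUnique_snd ha (adjSwap n i)).choose_spec.2 (a i)
    (Submonoid.subset_closure ⟨i, show i < n - 1 by omega, rfl⟩)).symm

end Coxeter

section Young

variable {n : ℕ} {μ : YoungDiagram}

/-- A filling `T` of the cells of `μ` with the numbers `0, …, n - 1`, each used once (`T a` is the
cell, given by its row and its column, that contains `a`), is standard if its entries increase
strictly along every row and along every column. -/
def IsStandard (T : Fin n ≃ μ.cells) : Prop :=
  (∀ a b, (T a).1.1 = (T b).1.1 → (T a).1.2 < (T b).1.2 → a < b) ∧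
    ∀ a b, (T a).1.2 = (T b).1.2 → (T a).1.1 < (T b).1.1 → a < b

/-- The standard Young tableaux of shape `μ` with entries `0, …, n - 1`. -/
abbrev StandardTableau (n : ℕ) (μ : YoungDiagram) : Type :=
  {T : Fin n ≃ μ.cells // IsStandard T}

noncomputable instance : Fintype (StandardTableau n μ) := Fintype.ofFinite _

/-- The content (column minus row) of the cell that contains the entry `i`. -/
def content (T : Fin n ≃ μ.cells) (i : ℕ) : ℤ :=
  if h : i < n then ((T ⟨i, h⟩).1.2 : ℤ) - ((T ⟨i, h⟩).1.1 : ℤ) else 0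

/-- The axial distance from the entry `i` to the entry `i + 1`. -/
def axialDist (T : Fin n ≃ μ.cells) (i : ℕ) : ℤ := content T (i + 1) - content T i

/-- The filling obtained from `T` by exchanging the entries `i` and `i + 1`. -/
def exchange (i : ℕ) (T : Fin n ≃ μ.cells) : Fin n ≃ μ.cells := (adjSwap n i).trans T

open Classical in
/-- The matrix of the adjacent transposition `(i, i + 1)` in Young's orthogonal form. With `r` the
axial distance from `i` to `i + 1` in `T`, the column of `T` has the entry `1 / r` in the row of `T`
and the entry `√(1 - 1 / r ^ 2)` in the row of the tableau obtained from `T` by exchanging `i` and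
`i + 1`, if this is standard. -/
noncomputable def youngGenerator (n : ℕ) (μ : YoungDiagram) (i : ℕ) :
    Matrix (StandardTableau n μ) (StandardTableau n μ) ℂ :=
  Matrix.of fun S T =>
    if S = T then ((1 / (axialDist T.1 i : ℝ) : ℝ) : ℂ)
    else if S.1 = exchange i T.1 then ((√(1 - 1 / (axialDist T.1 i : ℝ) ^ 2) : ℝ) : ℂ)
    else 0

theorem content_exchange {i : ℕ} (hi : i + 1 < n) (T : Fin n ≃ μ.cells) (j : ℕ) :
    content (exchange i T) j =
      content T (if j = i then i + 1 else if j = i + 1 then i else j) := by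
  unfold content exchange
  by_cases hj : j < n
  · have h1 : ((adjSwap n i ⟨j, hj⟩ : Fin n) : ℕ) =
        if j = i then i + 1 else if j = i + 1 then i else j := adjSwap_apply hi _
    have h2 : (if j = i then i + 1 else if j = i + 1 then i else j) < n := by
      rw [← h1]; exact Fin.isLt _
    have h3 : adjSwap n i ⟨j, hj⟩ =
        ⟨if j = i then i + 1 else if j = i + 1 then i else j, h2⟩ := Fin.ext h1
    rw [dif_pos hj, dif_pos h2, Equiv.trans_apply, h3]
  · rw [dif_neg hj, if_neg (by omega), if_neg (by omega), dif_neg hj]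

theorem exchange_exchange {i : ℕ} (hi : i + 1 < n) (T : Fin n ≃ μ.cells) :
    exchange i (exchange i T) = T := by
  unfold exchange
  have := (adjSwap_coxeterRel n).sq i (by omega)
  ext a : 1
  simp only [Equiv.trans_apply]
  rw [← Equiv.Perm.mul_apply, this, Equiv.Perm.one_apply]

theorem exchange_comm {i j : ℕ} (hij : i + 1 < j) (hj : j + 1 < n) (T : Fin n ≃ μ.cells) :
    exchange i (exchange j T) = exchange j (exchange i T) := by
  unfold exchange
  have := (adjSwap_coxeterRel n).comm i j hij (by omega)
  ext a : 1
  simp only [Equiv.trans_apply]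
  rw [← Equiv.Perm.mul_apply, ← this, Equiv.Perm.mul_apply]

theorem exchange_braid {i : ℕ} (hi : i + 2 < n) (T : Fin n ≃ μ.cells) :
    exchange i (exchange (i + 1) (exchange i T)) =
      exchange (i + 1) (exchange i (exchange (i + 1) T)) := by
  unfold exchange
  have := (adjSwap_coxeterRel n).braid i (by omega)
  ext a : 1
  simp only [Equiv.trans_apply]
  have h2 := congrArg (fun g : Equiv.Perm (Fin n) => g a) this
  simp only [Equiv.Perm.mul_apply] at h2
  rw [h2]

theorem exchange_ne {i : ℕ} (hi : i + 1 < n) (T : Fin n ≃ μ.cells) : exchange i T ≠ T := by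
  intro h
  have h1 := congrArg (fun S : Fin n ≃ μ.cells => S ⟨i, by omega⟩) h
  simp only [exchange, Equiv.trans_apply, EmbeddingLike.apply_eq_iff_eq] at h1
  have h2 := congrArg Fin.val h1
  rw [adjSwap_apply hi] at h2
  simp at h2

/-- Two entries of a standard tableau on the same diagonal differ by at least three. -/
theorem lt_of_content_eq {T : Fin n ≃ μ.cells} (hT : IsStandard T) (a b : Fin n) (hab : a ≠ b)
    (hrow : (T a).1.1 ≤ (T b).1.1)
    (h : ((T a).1.2 : ℤ) - (T a).1.1 = (T b).1.2 - (T b).1.1) : (a : ℕ) + 2 < b := by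
  have hne : (T a).1.1 ≠ (T b).1.1 := by
    intro h1
    apply hab
    apply T.injective
    apply Subtype.ext
    exact Prod.ext h1 (by omega)
  have hb : ((T b).1.1, (T b).1.2) ∈ μ := (T b).2
  have m1 : ((T a).1.1, (T b).1.2) ∈ μ.cells := μ.up_left_mem (by omega) le_rfl hb
  have m2 : ((T b).1.1, (T a).1.2) ∈ μ.cells := μ.up_left_mem le_rfl (by omega) hb
  obtain ⟨c, hc⟩ := T.surjective ⟨_, m1⟩
  obtain ⟨d, hd⟩ := T.surjective ⟨_, m2⟩
  have h1 : a < c := hT.1 a c (by rw [hc]) (by rw [hc]; simp only; omega)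
  have h2 : c < b := hT.2 c b (by rw [hc]) (by rw [hc]; simp only; omega)
  have h3 : a < d := hT.2 a d (by rw [hd]) (by rw [hd]; simp only; omega)
  have h4 : d < b := hT.1 d b (by rw [hd]) (by rw [hd]; simp only; omega)
  have h5 : c ≠ d := by
    rintro rfl
    rw [hc] at hd
    have := congrArg (fun x : μ.cells => x.1.1) hd
    simp only at this
    omega
  have h6 : (c : ℕ) ≠ d := fun h => h5 (Fin.ext h)
  omega

theorem content_ne {T : Fin n ≃ μ.cells} (hT : IsStandard T) {i j : ℕ} (hij : i < j)
    (hj : j ≤ i + 2) (hn : j < n) : content T i ≠ content T j := by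
  intro h
  unfold content at h
  rw [dif_pos (by omega), dif_pos hn] at h
  rcases le_total (T ⟨i, by omega⟩).1.1 (T ⟨j, hn⟩).1.1 with h1 | h1
  · have := lt_of_content_eq hT ⟨i, by omega⟩ ⟨j, hn⟩ (by simp; omega) h1 h
    simp only at this
    omega
  · have := lt_of_content_eq hT ⟨j, hn⟩ ⟨i, by omega⟩ (by simp; omega) h1 h.symm
    simp only at this
    omega

/-- If exchanging `i` and `i + 1` destroys standardness, they are neighbours in a row or column. -/
theorem axialDist_sq_of_not_standard {T : Fin n ≃ μ.cells} (hT : IsStandard T) {i : ℕ}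
    (hi : i + 1 < n) (h : ¬ IsStandard (exchange i T)) : axialDist T i ^ 2 = 1 := by
  set p : Fin n := ⟨i, by omega⟩ with hp
  set q : Fin n := ⟨i + 1, hi⟩ with hq
  have hax : axialDist T i = ((T q).1.2 - (T q).1.1) - ((T p).1.2 - (T p).1.1) := by
    unfold axialDist content
    rw [dif_pos hi, dif_pos (by omega)]
  -- a pair in increasing order whose order is reversed by the exchange is `i`, `i + 1`
  have key : ∀ a b : Fin n, adjSwap n i a < adjSwap n i b → ¬ a < b →
      adjSwap n i a = p ∧ adjSwap n i b = q := by
    intro a b h1 h2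
    have e1 := adjSwap_apply hi a
    have e2 := adjSwap_apply hi b
    simp only [Fin.ext_iff, Fin.lt_def, hp, hq] at h1 h2 ⊢
    rw [e1, e2] at h1 ⊢
    split_ifs at h1 ⊢ <;> omega
  unfold IsStandard exchange at h
  rw [not_and_or] at h
  simp only [not_forall, Equiv.trans_apply] at h
  rcases h with ⟨a, b, h1, h2, h3⟩ | ⟨a, b, h1, h2, h3⟩
  · obtain ⟨ha, hb⟩ := key a b (hT.1 _ _ h1 h2) h3
    rw [ha, hb] at h1 h2
    have hadj : (T q).1.2 = (T p).1.2 + 1 := by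
      by_contra hne
      have hqm : ((T q).1.1, (T q).1.2) ∈ μ := (T q).2
      have m : ((T q).1.1, (T p).1.2 + 1) ∈ μ.cells := μ.up_left_mem le_rfl (by omega) hqm
      obtain ⟨c, hc⟩ := T.surjective ⟨_, m⟩
      have l1 : p < c := hT.1 p c (by rw [hc]; exact h1) (by rw [hc]; simp)
      have l2 : c < q := hT.1 c q (by rw [hc]) (by rw [hc]; simp only; omega)
      simp only [Fin.lt_def, hp, hq] at l1 l2
      omega
    have : axialDist T i = 1 := by rw [hax]; omega
    rw [this]; norm_num
  · obtain ⟨ha, hb⟩ := key a b (hT.2 _ _ h1 h2) h3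
    rw [ha, hb] at h1 h2
    have hadj : (T q).1.1 = (T p).1.1 + 1 := by
      by_contra hne
      have hqm : ((T q).1.1, (T q).1.2) ∈ μ := (T q).2
      have m : ((T p).1.1 + 1, (T q).1.2) ∈ μ.cells := μ.up_left_mem (by omega) le_rfl hqm
      obtain ⟨c, hc⟩ := T.surjective ⟨_, m⟩
      have l1 : p < c := hT.2 p c (by rw [hc]; exact h1) (by rw [hc]; simp)
      have l2 : c < q := hT.2 c q (by rw [hc]) (by rw [hc]; simp only; omega)
      simp only [Fin.lt_def, hp, hq] at l1 l2
      omega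
    have : axialDist T i = -1 := by rw [hax]; omega
    rw [this]; norm_num

theorem axialDist_exchange {i : ℕ} (hi : i + 1 < n) (T : Fin n ≃ μ.cells) :
    axialDist (exchange i T) i = - axialDist T i := by
  unfold axialDist
  rw [content_exchange hi, content_exchange hi]
  simp

/-- The off-diagonal coefficient of the orthogonal form, as a function of the axial distance. -/
noncomputable def offDiag (r : ℤ) : ℂ := ((√(1 - 1 / (r : ℝ) ^ 2) : ℝ) : ℂ)

theorem offDiag_neg (r : ℤ) : offDiag (-r) = offDiag r := by
  simp [offDiag]

theorem offDiag_sq {r : ℤ} (hr : r ≠ 0) : offDiag r ^ 2 = 1 - (1 / (r : ℂ)) ^ 2 := by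
  have h1 : (1 : ℝ) ≤ (r : ℝ) ^ 2 := by
    have : (1 : ℤ) ≤ r ^ 2 := by have := sq_pos_of_ne_zero hr; omega
    exact_mod_cast this
  have h2 : (0 : ℝ) ≤ 1 - 1 / (r : ℝ) ^ 2 := by
    rw [sub_nonneg, div_le_one (by linarith)]
    exact h1
  unfold offDiag
  rw [← Complex.ofReal_pow, Real.sq_sqrt h2]
  push_cast
  ring

theorem offDiag_of_sq_eq_one {r : ℤ} (hr : r ^ 2 = 1) : offDiag r = 0 := by
  have : (r : ℝ) ^ 2 = 1 := by exact_mod_cast hr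
  simp [offDiag, this]

/-- The operator of the orthogonal form on functions on all fillings. -/
noncomputable def fillingOp (i : ℕ) (v : (Fin n ≃ μ.cells) → ℂ) (T : Fin n ≃ μ.cells) : ℂ :=
  1 / (axialDist T i : ℂ) * v T + offDiag (axialDist T i) * v (exchange i T)

open Classical in
/-- Extension by zero of a function on the standard tableaux to all fillings. -/
noncomputable def extendZero (v : StandardTableau n μ → ℂ) (T : Fin n ≃ μ.cells) : ℂ :=
  if h : IsStandard T then v ⟨T, h⟩ else 0

theorem extendZero_val (v : StandardTableau n μ → ℂ) (T : StandardTableau n μ) :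
    extendZero v T.1 = v T := by
  unfold extendZero
  rw [dif_pos T.2]

theorem extendZero_mulVec {i : ℕ} (hi : i + 1 < n) (v : StandardTableau n μ → ℂ) :
    extendZero ((youngGenerator n μ i).mulVec v) = fillingOp i (extendZero v) := by
  classical
  ext T
  by_cases hT : IsStandard T
  · have hentry : ∀ S : StandardTableau n μ, youngGenerator n μ i ⟨T, hT⟩ S * v S =
        (if S = ⟨T, hT⟩ then 1 / (axialDist T i : ℂ) * v S else 0) +
          (if S.1 = exchange i T then offDiag (axialDist T i) * v S else 0) := by
      intro S
      by_cases h1 : S = ⟨T, hT⟩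
      · subst h1
        rw [if_pos rfl, if_neg (exchange_ne hi T).symm]
        simp [youngGenerator]
      · rw [if_neg h1, zero_add]
        by_cases h2 : S.1 = exchange i T
        · have h3 : T = exchange i S.1 := by rw [h2, exchange_exchange hi]
          rw [if_pos h2]
          unfold youngGenerator
          rw [Matrix.of_apply, if_neg (Ne.symm h1), if_pos h3]
          rw [h2, axialDist_exchange hi]
          rw [← offDiag_neg]
          rfl
        · have h3 : T ≠ exchange i S.1 := by
            intro h
            apply h2
            rw [h, exchange_exchange hi]
          rw [if_neg h2]
          unfold youngGenerator
          rw [Matrix.of_apply, if_neg (Ne.symm h1), if_neg h3, zero_mul]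
    have hlhs : extendZero ((youngGenerator n μ i).mulVec v) T =
        ∑ S, youngGenerator n μ i ⟨T, hT⟩ S * v S := by
      unfold extendZero
      rw [dif_pos hT]
      rfl
    rw [hlhs, Finset.sum_congr rfl (fun S _ => hentry S), Finset.sum_add_distrib]
    unfold fillingOp
    congr 1
    · rw [Finset.sum_ite_eq' Finset.univ _ _, if_pos (Finset.mem_univ _)]
      unfold extendZero
      rw [dif_pos hT]
    · by_cases hE : IsStandard (exchange i T)
      · have : ∀ S : StandardTableau n μ, (S.1 = exchange i T) = (S = ⟨exchange i T, hE⟩) := by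
          intro S
          rw [Subtype.ext_iff]
        simp only [this]
        rw [Finset.sum_ite_eq' Finset.univ _ _, if_pos (Finset.mem_univ _)]
        unfold extendZero
        rw [dif_pos hE]
      · rw [Finset.sum_eq_zero]
        · unfold extendZero
          rw [dif_neg hE, mul_zero]
        · intro S _
          rw [if_neg]
          intro h
          exact hE (h ▸ S.2)
  · have h0 : ∀ w : StandardTableau n μ → ℂ, extendZero w T = 0 := by
      intro w
      unfold extendZero
      rw [dif_neg hT]
    unfold fillingOp
    rw [h0, h0, mul_zero, zero_add]
    by_cases hE : IsStandard (exchange i T)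
    · have h1 := axialDist_sq_of_not_standard hE hi (by rwa [exchange_exchange hi])
      rw [axialDist_exchange hi, neg_sq] at h1
      rw [offDiag_of_sq_eq_one h1, zero_mul]
    · unfold extendZero
      rw [dif_neg hE, mul_zero]

theorem ext_of_extendZero {A B : Matrix (StandardTableau n μ) (StandardTableau n μ) ℂ}
    (h : ∀ v (T : StandardTableau n μ),
      extendZero (A.mulVec v) T.1 = extendZero (B.mulVec v) T.1) : A = B := by
  classical
  apply Matrix.ext_of_mulVec_single
  intro S
  ext T
  rw [← extendZero_val (Matrix.mulVec A _), h, extendZero_val]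

theorem youngGenerator_sq {i : ℕ} (hi : i + 1 < n) :
    youngGenerator n μ i * youngGenerator n μ i = 1 := by
  apply ext_of_extendZero
  intro v T
  rw [← Matrix.mulVec_mulVec, Matrix.one_mulVec, extendZero_mulVec hi, extendZero_mulVec hi]
  generalize extendZero v = w
  have hr : axialDist T.1 i ≠ 0 :=
    sub_ne_zero.mpr (content_ne T.2 (by omega) (by omega) hi).symm
  unfold fillingOp
  rw [axialDist_exchange hi, exchange_exchange hi, offDiag_neg]
  have h1 := offDiag_sq hr
  push_cast
  rw [div_neg]
  linear_combination w T.1 * h1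

theorem youngGenerator_comm {i j : ℕ} (hij : i + 1 < j) (hj : j + 1 < n) :
    youngGenerator n μ i * youngGenerator n μ j = youngGenerator n μ j * youngGenerator n μ i := by
  apply ext_of_extendZero
  intro v T
  have hi : i + 1 < n := by omega
  rw [← Matrix.mulVec_mulVec, ← Matrix.mulVec_mulVec, extendZero_mulVec hi, extendZero_mulVec hj,
    extendZero_mulVec hj, extendZero_mulVec hi]
  generalize extendZero v = w
  have h1 : axialDist (exchange i T.1) j = axialDist T.1 j := by
    unfold axialDist
    rw [content_exchange hi, content_exchange hi]
    rw [if_neg (by omega), if_neg (by omega), if_neg (by omega), if_neg (by omega)]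
  have h2 : axialDist (exchange j T.1) i = axialDist T.1 i := by
    unfold axialDist
    rw [content_exchange hj, content_exchange hj]
    rw [if_neg (by omega), if_neg (by omega), if_neg (by omega), if_neg (by omega)]
  unfold fillingOp
  rw [h1, h2, exchange_comm hij hj]
  ring

theorem youngGenerator_braid {i : ℕ} (hi : i + 2 < n) :
    youngGenerator n μ i * youngGenerator n μ (i + 1) * youngGenerator n μ i =
      youngGenerator n μ (i + 1) * youngGenerator n μ i * youngGenerator n μ (i + 1) := by
  apply ext_of_extendZero
  intro v T
  have hi1 : i + 1 < n := by omega
  have hi2 : i + 1 + 1 < n := by omega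
  simp only [← Matrix.mulVec_mulVec]
  simp only [extendZero_mulVec hi1, extendZero_mulVec hi2]
  generalize extendZero v = w
  have hab := content_ne T.2 (i := i) (j := i + 1) (by omega) (by omega) (by omega)
  have hbc := content_ne T.2 (i := i + 1) (j := i + 2) (by omega) (by omega) (by omega)
  have hac := content_ne T.2 (i := i) (j := i + 2) (by omega) (by omega) (by omega)
  have e1 : ∀ U : Fin n ≃ μ.cells, content (exchange i U) i = content U (i + 1) := by
    intro U; rw [content_exchange hi1]; simp
  have e2 : ∀ U : Fin n ≃ μ.cells, content (exchange i U) (i + 1) = content U i := by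
    intro U; rw [content_exchange hi1]; simp
  have e3 : ∀ U : Fin n ≃ μ.cells, content (exchange i U) (i + 1 + 1) = content U (i + 1 + 1) := by
    intro U; rw [content_exchange hi1]; rw [if_neg (by omega), if_neg (by omega)]
  have e4 : ∀ U : Fin n ≃ μ.cells, content (exchange (i + 1) U) i = content U i := by
    intro U; rw [content_exchange hi2]; rw [if_neg (by omega), if_neg (by omega)]
  have e5 : ∀ U : Fin n ≃ μ.cells,
      content (exchange (i + 1) U) (i + 1) = content U (i + 1 + 1) := by
    intro U; rw [content_exchange hi2]; simp
  have e6 : ∀ U : Fin n ≃ μ.cells,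
      content (exchange (i + 1) U) (i + 1 + 1) = content U (i + 1) := by
    intro U; rw [content_exchange hi2]; simp
  unfold fillingOp
  simp only [axialDist, e1, e2, e3, e4, e5, e6, exchange_exchange hi1, exchange_exchange hi2,
    exchange_braid hi]
  have hsym : ∀ x y : ℤ, offDiag (x - y) = offDiag (y - x) := by
    intro x y
    rw [← neg_sub, offDiag_neg]
  set a := content T.1 i
  set b := content T.1 (i + 1)
  set c := content T.1 (i + 1 + 1)
  rw [hsym a b, hsym b c]
  have s1 := offDiag_sq (sub_ne_zero.mpr hab.symm)
  have s2 := offDiag_sq (sub_ne_zero.mpr hbc.symm)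
  have h1 : ((b - a : ℤ) : ℂ) ≠ 0 := Int.cast_ne_zero.mpr (sub_ne_zero.mpr hab.symm)
  have h2 : ((c - b : ℤ) : ℂ) ≠ 0 := Int.cast_ne_zero.mpr (sub_ne_zero.mpr hbc.symm)
  have h3 : ((c - a : ℤ) : ℂ) ≠ 0 := Int.cast_ne_zero.mpr (sub_ne_zero.mpr hac.symm)
  have n1 : 1 / ((a - b : ℤ) : ℂ) = -(1 / ((b - a : ℤ) : ℂ)) := by
    rw [← neg_sub b a, Int.cast_neg, div_neg]
  have n2 : 1 / ((b - c : ℤ) : ℂ) = -(1 / ((c - b : ℤ) : ℂ)) := by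
    rw [← neg_sub c b, Int.cast_neg, div_neg]
  have hz : 1 / ((b - a : ℤ) : ℂ) * (1 / ((c - b : ℤ) : ℂ)) =
      1 / ((c - a : ℤ) : ℂ) * (1 / ((b - a : ℤ) : ℂ) + 1 / ((c - b : ℤ) : ℂ)) := by
    field_simp
    push_cast
    ring
  rw [n1, n2]
  generalize 1 / ((b - a : ℤ) : ℂ) = x at *
  generalize 1 / ((c - b : ℤ) : ℂ) = y at *
  generalize 1 / ((c - a : ℤ) : ℂ) = z at *
  linear_combination w T.1 * z * s1 - w T.1 * z * s2 +
    (w T.1 * (x - y) + offDiag (b - a) * w (exchange i T.1) -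
      offDiag (c - b) * w (exchange (i + 1) T.1)) * hz

/-- The matrices of the orthogonal form as invertible matrices. -/
noncomputable def youngUnit (n : ℕ) (μ : YoungDiagram) (i : ℕ) :
    (Matrix (StandardTableau n μ) (StandardTableau n μ) ℂ)ˣ :=
  if h : i + 1 < n then
    ⟨youngGenerator n μ i, youngGenerator n μ i, youngGenerator_sq h, youngGenerator_sq h⟩
  else 1

theorem youngUnit_val {i : ℕ} (h : i + 1 < n) :
    (youngUnit n μ i : Matrix (StandardTableau n μ) (StandardTableau n μ) ℂ) =
      youngGenerator n μ i := by
  unfold youngUnit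
  rw [dif_pos h]

theorem youngUnit_coxeterRel (n : ℕ) (μ : YoungDiagram) :
    CoxeterRel (youngUnit n μ) (n - 1) where
  sq i hi := by
    ext1
    rw [Units.val_mul, youngUnit_val (by omega), youngGenerator_sq (by omega), Units.val_one]
  comm i j hij hj := by
    ext1
    rw [Units.val_mul, Units.val_mul, youngUnit_val (by omega), youngUnit_val (by omega),
      youngGenerator_comm hij (by omega)]
  braid i hi := by
    ext1
    simp only [Units.val_mul]
    rw [youngUnit_val (by omega), youngUnit_val (by omega), youngGenerator_braid (by omega)]

/-- The Young orthogonal representation of the symmetric group that is labelled by `μ`: the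
homomorphism that sends each adjacent transposition to its matrix in Young's orthogonal form. -/
noncomputable def youngRep (n : ℕ) (μ : YoungDiagram) :
    Equiv.Perm (Fin n) →* Matrix (StandardTableau n μ) (StandardTableau n μ) ℂ :=
  (Units.coeHom _).comp (liftCoxeter (youngUnit_coxeterRel n μ))

theorem youngRep_adjSwap (n : ℕ) (μ : YoungDiagram) (i : ℕ) (hi : i + 1 < n) :
    youngRep n μ (adjSwap n i) = youngGenerator n μ i := by
  unfold youngRep
  rw [MonoidHom.comp_apply, liftCoxeter_adjSwap _ i hi, Units.coeHom_apply, youngUnit_val hi]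

end Young

section Spectrum

variable {n d k : ℕ}

/-- The subgroup of the permutations that fix the last two letters, a copy of the symmetric group
on the first `n - 2` letters. -/
def symSubTwo (n : ℕ) : Subgroup (Equiv.Perm (Fin n)) where
  carrier := {h | ∀ a : Fin n, n ≤ (a : ℕ) + 2 → h a = a}
  one_mem' _ _ := rfl
  mul_mem' {g h} hg hh a ha := by rw [Equiv.Perm.mul_apply, hh a ha, hg a ha]
  inv_mem' {g} hg a ha := by rw [Equiv.Perm.inv_eq_iff_eq, hg a ha]

/-- `f` is a function on the left cosets of the copy of the symmetric group on `n - 2` letters. -/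
def IsRightInvariant (f : Equiv.Perm (Fin n) → Fin d → ℂ) : Prop :=
  ∀ g, ∀ h ∈ symSubTwo n, f (g * h) = f g

/-- The Fourier transform `(1 / n!) ∑ g, φ g • ρ g` at the Young orthogonal representation `ρ`
labelled by `μ`. -/
noncomputable def fourier (φ : Equiv.Perm (Fin n) → ℂ) (μ : YoungDiagram) :
    Matrix (StandardTableau n μ) (StandardTableau n μ) ℂ :=
  (1 / (Fintype.card (Equiv.Perm (Fin n)) : ℂ)) • ∑ g, φ g • youngRep n μ g

/-- The transform
`r̂ = ∑ g, (f_{i_{k-1}} (g) * ∏_{l = 1}^{k-2} f_{i_l} (g * g_l)) / n! • ρ g`, for the list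
`I = (i_1, …, i_{k-1})` and the group elements `G = (g_1, …, g_{k-2})`, both counted from `0` here. -/
noncomputable def rHat (hk : 2 ≤ k) (f : Equiv.Perm (Fin n) → Fin d → ℂ)
    (I : Fin (k - 1) → Fin d) (G : Fin (k - 2) → Equiv.Perm (Fin n)) (μ : YoungDiagram) :
    Matrix (StandardTableau n μ) (StandardTableau n μ) ℂ :=
  fourier (fun g => f g (I ⟨k - 2, by omega⟩) *
    ∏ l : Fin (k - 2), f (g * G l) (I ⟨l, by omega⟩)) μ

/-- The entry of the `k`-spectrum of `f` at `G` and `μ`: the direct sum (block diagonal matrix), over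
all lists `I = (i_1, …, i_k)` of indices, of `r̂ᴴ * f̂_{i_k}`, with `r̂` taken for
`(i_1, …, i_{k-1})`. -/
noncomputable def kSpectrum (hk : 2 ≤ k) (f : Equiv.Perm (Fin n) → Fin d → ℂ)
    (G : Fin (k - 2) → Equiv.Perm (Fin n)) (μ : YoungDiagram) :
    Matrix (StandardTableau n μ × (Fin k → Fin d)) (StandardTableau n μ × (Fin k → Fin d)) ℂ :=
  Matrix.blockDiagonal fun I : Fin k → Fin d =>
    (rHat hk f (fun j => I ⟨j, by omega⟩) G μ).conjTranspose *
      fourier (fun g => f g (I ⟨k - 1, by omega⟩)) μ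

/-- The partitions `(n)`, `(n - 1, 1)`, `(n - 2, 2)`, `(n - 2, 1, 1)`, as far as they are partitions
of `n` (for small `n` not all of these lists are). -/
def lambdaSet (n : ℕ) : Set YoungDiagram :=
  {μ | μ.rowLens = [n] ∨ μ.rowLens = [n - 1, 1] ∨ μ.rowLens = [n - 2, 2] ∨
    μ.rowLens = [n - 2, 1, 1]}

end Spectrum

end KSpec

/-!
The entries of the `k`-spectrum of a function `f` on the cosets of `S_{n-2}` at `μ ∈ Λ_n` and
`G ∈ Y^{k-2}` contain all the others, for two independent reasons.

* `r̂ (G, ρ)` depends on the entries `g_l` of `G` only through the values `f (g * g_l)`, hence only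
  through the cosets `g_l S_{n-2}` (`kSpectrum_congr_cosets`), and each coset is represented in `Y`.
* The second factor `f̂ (ρ)` of every block satisfies `f̂ (ρ) * ρ h = f̂ (ρ)` for `h ∈ S_{n-2}`
  (`fourier_mul_youngRep`). Since the generators of the orthogonal form are symmetric matrices, the
  rows of `f̂ (ρ)` are vectors fixed by `S_{n-2}`. If `ρ = ρ_μ` has a nonzero such vector, then `μ`
  is one of the four shapes in `lambdaSet n`; so `f̂ (ρ_μ) = 0` for every other `μ`, and both
  spectra vanish there.

The statement on fixed vectors is a case of the branching rule, but the orthogonal form gives it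
directly (`extendZero_eq_zero`): the coordinate of a fixed vector at a standard tableau `T` vanishes
as soon as some entry `m ≤ n - 2` (counted from `1`) lies outside the first row. Take the
smallest such `m`. It lies in the first column, and `m - 1` lies in the first row, so the axial
distance `r` from `m - 1` to `m` is negative, and invariance under `(m - 1, m)` expresses
`(1 - 1 / r) v_T` as a multiple of the coordinate at the tableau with `m - 1` and `m` exchanged.
There `m - 1` is outside the first row, and induction on `m` applies. Hence a nonzero fixed vector
forces the first row of `μ` to have at least `n - 2` cells (`le_rowLen_zero_of_fixed`).
-/

namespace KSpec

/-! ### Shapes with a long first row -/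

section Shapes

theorem sum_rowLens (μ : YoungDiagram) : μ.rowLens.sum = μ.card := by
  have h : ∀ c ∈ μ.cells, c.1 ∈ Finset.range (μ.colLen 0) := fun c hc =>
    Finset.mem_range.mpr (YoungDiagram.mem_iff_lt_colLen.mp (μ.up_left_mem le_rfl c.2.zero_le hc))
  unfold YoungDiagram.card YoungDiagram.rowLens
  rw [Finset.card_eq_sum_card_fiberwise h, ← List.sum_toFinset _ List.nodup_range,
    List.toFinset_range]
  exact Finset.sum_congr rfl fun i _ => μ.rowLen_eq_card

theorem mem_lambdaSet_of_le_rowLen {n : ℕ} (hn : 2 ≤ n) {μ : YoungDiagram} (hμ : μ.card = n)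
    (h : n ≤ μ.rowLen 0 + 2) : μ ∈ lambdaSet n := by
  have hsum := sum_rowLens μ
  have hpos := μ.pos_of_mem_rowLens
  have hsort := μ.rowLens_sorted.pairwise
  have hhead : ∀ a l, μ.rowLens = a :: l → n ≤ a + 2 := by
    intro a l hl
    have h0 : 0 < μ.rowLens.length := by simp [hl]
    have h1 := YoungDiagram.get_rowLens (h := h0)
    simp only [hl, List.getElem_cons_zero] at h1
    rwa [h1]
  unfold lambdaSet
  rw [Set.mem_ofPred_eq]
  rw [hμ] at hsum
  generalize μ.rowLens = w at *
  match w with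
  | [] => simp at hsum; omega
  | [a] => simp at hsum; simp [hsum]
  | [a, b] =>
    have := hhead _ _ rfl
    simp at hsum hpos hsort
    simp
    omega
  | [a, b, c] =>
    have := hhead _ _ rfl
    simp at hsum hpos hsort
    simp
    omega
  | a :: b :: c :: e :: l =>
    have := hhead _ _ rfl
    simp at hsum hpos
    omega

end Shapes

/-! ### Vectors fixed by the first adjacent transpositions -/

section Fixed

variable {n : ℕ} {μ : YoungDiagram}

theorem youngGenerator_transpose {i : ℕ} (hi : i + 1 < n) :
    (youngGenerator n μ i).transpose = youngGenerator n μ i := by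
  ext S T
  rw [Matrix.transpose_apply]
  unfold youngGenerator
  simp only [Matrix.of_apply]
  by_cases h1 : S = T
  · rw [h1]
  rw [if_neg h1, if_neg (Ne.symm h1)]
  by_cases h2 : S.1 = exchange i T.1
  · have h3 : T.1 = exchange i S.1 := by rw [h2, exchange_exchange hi]
    rw [if_pos h2, if_pos h3, h2, axialDist_exchange hi]
    simp
  · have h3 : T.1 ≠ exchange i S.1 := fun h => h2 (by rw [h, exchange_exchange hi])
    rw [if_neg h2, if_neg h3]

/-- The smallest entry of a standard tableau outside the first row lies in the first column, and is
not the smallest entry of all. -/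
theorem first_entry_outside_row {T : Fin n ≃ μ.cells} (hT : IsStandard T) (b : Fin n)
    (hb : (T b).1.1 ≠ 0) (hlt : ∀ a < b, (T a).1.1 = 0) : (T b).1.2 = 0 ∧ 0 < (b : ℕ) := by
  have hbm : ((T b).1.1, (T b).1.2) ∈ μ := (T b).2
  constructor
  · by_contra hc
    obtain ⟨a, ha⟩ := T.surjective ⟨((T b).1.1, 0), μ.up_left_mem le_rfl (Nat.zero_le _) hbm⟩
    have hab : a < b := hT.1 a b (by rw [ha]) (by rw [ha]; exact Nat.pos_of_ne_zero hc)
    have := hlt a hab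
    rw [ha] at this
    exact hb this
  · obtain ⟨a, ha⟩ := T.surjective ⟨(0, (T b).1.2), μ.up_left_mem (Nat.zero_le _) le_rfl hbm⟩
    have hab : a < b := hT.2 a b (by rw [ha]) (by rw [ha]; exact Nat.pos_of_ne_zero hb)
    exact lt_of_le_of_lt (Nat.zero_le _) hab

/-- A vector fixed by the adjacent transpositions of the first `N` letters has coordinate zero at
each tableau in which `b`, one of these letters, is the first to lie outside the first row. -/
theorem extendZero_eq_zero {v : StandardTableau n μ → ℂ} {N : ℕ} (hN : N ≤ n)
    (hv : ∀ i, i + 1 < N → (youngGenerator n μ i).mulVec v = v) :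
    ∀ (b : ℕ) (hb : b < N) (T : Fin n ≃ μ.cells), (T ⟨b, by omega⟩).1.1 ≠ 0 →
      (∀ a : Fin n, (a : ℕ) < b → (T a).1.1 = 0) → extendZero v T = 0 := by
  intro b
  induction b with
  | zero =>
    intro hb T hT0 hlt
    unfold extendZero
    refine dif_neg fun hT => ?_
    have := (first_entry_outside_row hT _ hT0 hlt).2
    simp at this
  | succ p ih =>
    intro hb T hT0 hlt
    by_cases hT : IsStandard T
    swap
    · exact dif_neg hT
    have hp : p + 1 < n := by omega
    have hfix := congrFun (extendZero_mulVec hp v) T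
    rw [hv p hb, fillingOp] at hfix
    -- exchanging `p` and `p + 1` moves the first entry outside the first row from `p + 1` to `p`
    have hE : extendZero v (exchange p T) = 0 := by
      have happ : ∀ a : Fin n, ((adjSwap n p a : Fin n) : ℕ) = _ := adjSwap_apply hp
      refine ih (by omega) _ ?_ fun a ha => ?_
      · have : adjSwap n p ⟨p, by omega⟩ = ⟨p + 1, hp⟩ := by
          ext; rw [happ]; simp
        rw [exchange, Equiv.trans_apply, this]
        exact hT0
      · have : adjSwap n p a = a := by
          ext; rw [happ, if_neg (by omega), if_neg (by omega)]
        rw [exchange, Equiv.trans_apply, this]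
        exact hlt a (by omega)
    have hcol := (first_entry_outside_row hT _ hT0 hlt).1
    have hrow := hlt ⟨p, by omega⟩ (Nat.lt_succ_self p)
    have hneg : axialDist T p < 0 := by
      unfold axialDist content
      rw [dif_pos hp, dif_pos (by omega)]
      omega
    have hr : (axialDist T p : ℂ) ≠ 0 := Int.cast_ne_zero.mpr hneg.ne
    have hr1 : (axialDist T p : ℂ) - 1 ≠ 0 := by
      have : axialDist T p - 1 ≠ 0 := by omega
      exact_mod_cast this
    rw [hE, mul_zero, add_zero] at hfix
    field_simp at hfix
    have h0 : ((axialDist T p : ℂ) - 1) * extendZero v T = 0 := by linear_combination hfix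
    exact (mul_eq_zero.mp h0).resolve_left hr1

theorem le_rowLen_zero_of_fixed {v : StandardTableau n μ → ℂ} {N : ℕ} (hN : N ≤ n)
    (hv : ∀ i, i + 1 < N → (youngGenerator n μ i).mulVec v = v) (h0 : v ≠ 0) :
    N ≤ μ.rowLen 0 := by
  obtain ⟨T, hT⟩ := Function.ne_iff.mp h0
  rw [← extendZero_val v T] at hT
  have hrow : ∀ b : ℕ, ∀ hb : b < N, (T.1 ⟨b, by omega⟩).1.1 = 0 := by
    intro b
    induction b using Nat.strong_induction_on with
    | _ b ih =>
      intro hb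
      by_contra hne
      exact hT (extendZero_eq_zero hN hv b hb T.1 hne fun a ha => ih a ha (by omega))
  rw [μ.rowLen_eq_card, ← Fintype.card_fin N, ← Finset.card_univ]
  refine Finset.card_le_card_of_injOn (fun b : Fin N => (T.1 ⟨b, by omega⟩).1) ?_ ?_
  · intro b _
    exact YoungDiagram.mem_row_iff.mpr ⟨(T.1 _).2, hrow b b.2⟩
  · intro a _ b _ hab
    have := T.1.injective (Subtype.ext hab)
    exact Fin.ext (Fin.mk.inj this)

end Fixed

/-! ### Fourier transforms and spectra of functions on the cosets -/

section Cosets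

variable {n d k : ℕ}

theorem adjSwap_mem_symSubTwo {i : ℕ} (hi : i + 1 < n - 2) : adjSwap n i ∈ symSubTwo n := by
  intro a ha
  ext
  rw [adjSwap_apply (by omega), if_neg (by omega), if_neg (by omega)]

theorem fourier_mul_youngRep {φ : Equiv.Perm (Fin n) → ℂ} {h : Equiv.Perm (Fin n)}
    (hφ : ∀ g, φ (g * h) = φ g) (μ : YoungDiagram) :
    fourier φ μ * youngRep n μ h = fourier φ μ := by
  unfold fourier
  rw [Matrix.smul_mul, Finset.sum_mul]
  congr 1
  refine Fintype.sum_equiv (Equiv.mulRight h) _ _ fun g => ?_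
  rw [Equiv.coe_mulRight, hφ, map_mul, Matrix.smul_mul]

theorem fourier_eq_zero (hn : 2 ≤ n) {φ : Equiv.Perm (Fin n) → ℂ}
    (hφ : ∀ g, ∀ h ∈ symSubTwo n, φ (g * h) = φ g) {μ : YoungDiagram} (hμ : μ.card = n)
    (hμΛ : μ ∉ lambdaSet n) : fourier φ μ = 0 := by
  by_contra hne
  obtain ⟨S, hS⟩ : ∃ S, fourier φ μ S ≠ 0 := Function.ne_iff.mp hne
  refine hμΛ (mem_lambdaSet_of_le_rowLen hn hμ ?_)
  have := le_rowLen_zero_of_fixed (v := fourier φ μ S) (Nat.sub_le n 2) (fun i hi => ?_) hS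
  · omega
  · have h1 := fourier_mul_youngRep (fun g => hφ g _ (adjSwap_mem_symSubTwo hi)) μ
    rw [youngRep_adjSwap n μ i (by omega)] at h1
    rw [← youngGenerator_transpose (by omega), Matrix.mulVec_transpose]
    exact congrFun h1 S

theorem kSpectrum_eq_zero (hn : 2 ≤ n) (hk : 2 ≤ k) {f : Equiv.Perm (Fin n) → Fin d → ℂ}
    (hf : IsRightInvariant f) {μ : YoungDiagram} (hμ : μ.card = n) (hμΛ : μ ∉ lambdaSet n)
    (G : Fin (k - 2) → Equiv.Perm (Fin n)) : kSpectrum hk f G μ = 0 := by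
  unfold kSpectrum
  rw [← Matrix.blockDiagonal_zero]
  congr 1
  funext I
  rw [fourier_eq_zero hn (fun g h hh => congrFun (hf g h hh) _) hμ hμΛ, mul_zero, Pi.zero_apply]

theorem kSpectrum_congr_cosets (hk : 2 ≤ k) {f : Equiv.Perm (Fin n) → Fin d → ℂ}
    (hf : IsRightInvariant f) (μ : YoungDiagram) {G G' : Fin (k - 2) → Equiv.Perm (Fin n)}
    (hG : ∀ l, ∃ h ∈ symSubTwo n, G' l * h = G l) : kSpectrum hk f G μ = kSpectrum hk f G' μ := by
  have : ∀ g l, f (g * G l) = f (g * G' l) := by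
    intro g l
    obtain ⟨h, hh, hl⟩ := hG l
    rw [← hl, ← mul_assoc, hf _ h hh]
  unfold kSpectrum rHat
  simp only [this]

end Cosets

end KSpec

theorem mainTheorem2 (n d k : ℕ) (hn : 2 ≤ n) (hk : 2 ≤ k)
    (Y : Set (Equiv.Perm (Fin n)))
    (hY : Subgroup.IsComplement Y (KSpec.symSubTwo n : Set (Equiv.Perm (Fin n))))
    (f f' : Equiv.Perm (Fin n) → Fin d → ℂ)
    (hf : KSpec.IsRightInvariant f) (hf' : KSpec.IsRightInvariant f')
    (heq : ∀ μ : YoungDiagram, μ.card = n → μ ∈ KSpec.lambdaSet n →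
      ∀ G : Fin (k - 2) → Equiv.Perm (Fin n), (∀ l, G l ∈ Y) →
        KSpec.kSpectrum hk f G μ = KSpec.kSpectrum hk f' G μ) :
    ∀ μ : YoungDiagram, μ.card = n → ∀ G : Fin (k - 2) → Equiv.Perm (Fin n),
      KSpec.kSpectrum hk f G μ = KSpec.kSpectrum hk f' G μ := by
  intro μ hμ G
  by_cases hΛ : μ ∈ KSpec.lambdaSet n
  · choose x hx _ using fun l => hY.existsUnique (G l)
    have hG : ∀ l, ∃ h ∈ KSpec.symSubTwo n, (x l).1.1 * h = G l :=
      fun l => ⟨(x l).2.1, (x l).2.2, hx l⟩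
    rw [KSpec.kSpectrum_congr_cosets hk hf μ hG, KSpec.kSpectrum_congr_cosets hk hf' μ hG]
    exact heq μ hμ hΛ _ fun l => (x l).1.2
  · rw [KSpec.kSpectrum_eq_zero hn hk hf hμ hΛ, KSpec.kSpectrum_eq_zero hn hk hf' hμ hΛ]
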